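/- Let $n_1,n_2,m\in\mathbb{N}$, $k_1,k_2\in\mathbb{R}$ and $\varepsilon>0$. All quantum systems are finite-dimensional, $\log$ is to base $2$, $\delta(\rho,\sigma)=\tfrac12\|\rho-\sigma\|_1$ is the trace distance, and $\omega_m=2^{-m}\,\mathrm{id}$ is the maximally mixed state on $m$ bits. For a state $\rho_{AB}$, the conditional min-entropy is $$H_{\min}(A|B)_\rho=\max_{\sigma_B}\,\max\{z\in\mathbb{R}:\rho_{AB}\le 2^{-z}\,\mathrm{id}_A\otimes\sigma_B\},$$ where $\sigma_B$ ranges over the density operators on $B$ (and an inner maximum over the empty set is $-\infty$); $H_{\min}(A)_\rho$ is the case of trivial $B$, i.e. the largest $z$ with $\rho_A\le 2^{-z}\,\mathrm{id}_A$. A function $\mathrm{Ext}:\{0,1\}^{n_1}\times\{0,1\}^{n_2}\to\{0,1\}^m$ is a $(k_1,k_2,\varepsilon)$ $X_1$-strong two-source extractor (without side information) if $$\delta\big(\rho_{\mathrm{Ext}(X_1,X_2)X_1},\ \omega_m\otimes\rho_{X_1}\big)\le\varepsilon$$ for all independent random variables $X_1\in\{0,1\}^{n_1}$ and $X_2\in\{0,1\}^{n_2}$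 with $H_{\min}(X_1)\ge k_1$ and $H_{\min}(X_2)\ge k_2$. It is a $(k_1,k_2,\varepsilon)$ $X_1$-strong two-source extractor against quantum product-type knowledge if $$\delta\big(\rho_{\mathrm{Ext}(X_1,X_2)X_1C},\ \omega_m\otimes\rho_{X_1C}\big)\le\varepsilon$$ for all states of the form $\rho_{X_1X_2C}=\rho_{X_1C_1}\otimes\rho_{X_2C_2}$ with $C=C_1C_2$, where $\rho_{X_iC_i}$ is a classical-quantum state, classical on $X_i\in\{0,1\}^{n_i}$, with $H_{\min}(X_1|C_1)\ge k_1$ and $H_{\min}(X_2|C_2)\ge k_2$. **Corollary.** Every $(k_1,k_2,\varepsilon)$ $X_1$-strong two-source extractor $\mathrm{Ext}:\{0,1\}^{n_1}\times\{0,1\}^{n_2}\to\{0,1\}^m$ is a $\big(k_1,\ k_2+\log\tfrac1\varepsilon,\ \sqrt{2^m\varepsilon}\big)$ $X_1$-strong two-source extractor against quantum product-type knowledge. -/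

import Mathlib

open scoped Kronecker ComplexOrder

universe u

noncomputable section

/-- The set `{0,1}^n` of `n`-bit strings. -/
abbrev BitString (n : ℕ) : Type := Fin n → Bool

/-! ### Operators on finite-dimensional systems

A system with orthonormal basis `(|a⟩)_{a : A}`, `A` a finite type, has Hilbert space `ℂ^A`; its
operators are the matrices indexed by `A`.  The joint system of `A` and `B` is indexed by `A × B`,
and the tensor product of operators is the Kronecker product `⊗ₖ`. -/

section Operators

variable {A : Type*} [Fintype A] [DecidableEq A]

/-- Density operators: positive semi-definite operators of trace one. -/
def IsDensityOperator (ρ : Matrix A A ℂ) : Prop :=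
  ρ.PosSemidef ∧ ρ.trace = 1

/-- The trace norm `‖S‖₁ = tr √(S† S)`. -/
def traceNorm (S : Matrix A A ℂ) : ℝ :=
  (cfc Real.sqrt (S.conjTranspose * S)).trace.re

/-- The trace distance `δ(ρ, σ) = ½ ‖ρ - σ‖₁`. -/
def traceDistance (ρ σ : Matrix A A ℂ) : ℝ :=
  1 / 2 * traceNorm (ρ - σ)

/-- The maximally mixed state `id / dim` of a system. -/
def maximallyMixed (A : Type*) [Fintype A] [DecidableEq A] : Matrix A A ℂ :=
  (Fintype.card A : ℂ)⁻¹ • (1 : Matrix A A ℂ)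

/-- The rank-one projector `|a⟩⟨a|` on a vector of the preferred basis. -/
def basisProjector (a : A) : Matrix A A ℂ :=
  Matrix.single a a 1

end Operators

section Classical

variable {X Y C : Type*} [Fintype X] [DecidableEq X] [Fintype Y] [DecidableEq Y]
  [Fintype C] [DecidableEq C]

/-- `ρ` is the state `∑ₓ P(x) |x⟩⟨x|` of a random variable on `X` with distribution `P`. -/
def IsClassicalState (ρ : Matrix X X ℂ) : Prop :=
  IsDensityOperator ρ ∧ ∃ P : X → ℝ, ρ = ∑ x, (P x : ℂ) • basisProjector x

/-- `ρ` is a classical-quantum state `ρ_{XC} = ∑ₓ |x⟩⟨x| ⊗ ρ_{C ∧ x}`, classical on `X`. -/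
def IsCQState (ρ : Matrix (X × C) (X × C) ℂ) : Prop :=
  IsDensityOperator ρ ∧ ∃ τ : X → Matrix C C ℂ, ρ = ∑ x, basisProjector x ⊗ₖ τ x

/-- The channel `ρ ↦ ρ_{f(X)} = ∑ₓ |f(x)⟩⟨f(x)| ⟨x|ρ|x⟩` of a function `f : X → Y`. -/
def applyFunction (f : X → Y) (ρ : Matrix X X ℂ) : Matrix Y Y ℂ :=
  ∑ x, ρ x x • basisProjector (f x)

/-- The channel of `f : X → Y` acting on the register `X` of `ρ_{XC}` and as the identity on `C`:
`ρ_{f(X)C} = ∑ₓ |f(x)⟩⟨f(x)| ⊗ ⟨x|ρ_{XC}|x⟩`. -/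
def applyFunctionLeft (f : X → Y) (ρ : Matrix (X × C) (X × C) ℂ) : Matrix (Y × C) (Y × C) ℂ :=
  ∑ x, basisProjector (f x) ⊗ₖ ρ.submatrix (Prod.mk x) (Prod.mk x)

end Classical

/-! ### Min-entropy -/

section MinEntropy

variable {A B : Type*} [Fintype A] [DecidableEq A] [Fintype B] [DecidableEq B]

/-- `H_min(ρ_{AB} | σ_B)`: the largest `z` with `ρ_{AB} ≤ 2^{-z} id_A ⊗ σ_B`, and `-∞` if there is
no such `z`. -/
def condMinEntropyRel (ρ : Matrix (A × B) (A × B) ℂ) (σ : Matrix B B ℂ) : EReal :=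
  sSup {z : EReal | ∃ r : ℝ, z = (r : EReal) ∧
    ((((2 : ℝ) ^ (-r) : ℝ) : ℂ) • ((1 : Matrix A A ℂ) ⊗ₖ σ) - ρ).PosSemidef}

/-- The conditional min-entropy `H_min(A|B)_ρ`: the supremum of `H_min(ρ_{AB} | σ_B)` over all
density operators `σ_B`. -/
def condMinEntropy (ρ : Matrix (A × B) (A × B) ℂ) : EReal :=
  sSup {z : EReal | ∃ σ : Matrix B B ℂ, IsDensityOperator σ ∧ z = condMinEntropyRel ρ σ}

/-- The min-entropy `H_min(A)_ρ` (trivial conditioning system): the largest `z` with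
`ρ_A ≤ 2^{-z} id_A`. -/
def minEntropy (ρ : Matrix A A ℂ) : EReal :=
  sSup {z : EReal | ∃ r : ℝ, z = (r : EReal) ∧
    ((((2 : ℝ) ^ (-r) : ℝ) : ℂ) • (1 : Matrix A A ℂ) - ρ).PosSemidef}

end MinEntropy

/-! ### Two-source extractors -/

/-- The product `ρ_{X₁C₁} ⊗ ρ_{X₂C₂}`, with registers ordered as `(X₁ X₂) (C₁ C₂)`. -/
def productState {X₁ X₂ C₁ C₂ : Type*}
    (ρ₁ : Matrix (X₁ × C₁) (X₁ × C₁) ℂ) (ρ₂ : Matrix (X₂ × C₂) (X₂ × C₂) ℂ) :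
    Matrix ((X₁ × X₂) × (C₁ × C₂)) ((X₁ × X₂) × (C₁ × C₂)) ℂ :=
  (ρ₁ ⊗ₖ ρ₂).submatrix (Equiv.prodProdProdComm X₁ X₂ C₁ C₂) (Equiv.prodProdProdComm X₁ X₂ C₁ C₂)

/-- `Ext` is a `(k₁, k₂, ε)` `X₁`-strong two-source extractor (no side information): for all
independent sources with `H_min(X₁) ≥ k₁` and `H_min(X₂) ≥ k₂`,
`δ(ρ_{Ext(X₁,X₂) X₁}, ω_m ⊗ ρ_{X₁}) ≤ ε`. -/
def IsX1StrongExtractor {n₁ n₂ m : ℕ} (k₁ k₂ ε : ℝ)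
    (Ext : BitString n₁ → BitString n₂ → BitString m) : Prop :=
  ∀ (ρ₁ : Matrix (BitString n₁) (BitString n₁) ℂ) (ρ₂ : Matrix (BitString n₂) (BitString n₂) ℂ),
    IsClassicalState ρ₁ → IsClassicalState ρ₂ →
    (k₁ : EReal) ≤ minEntropy ρ₁ → (k₂ : EReal) ≤ minEntropy ρ₂ →
    traceDistance
      (applyFunction (fun x : BitString n₁ × BitString n₂ => (Ext x.1 x.2, x.1)) (ρ₁ ⊗ₖ ρ₂))
      (maximallyMixed (BitString m) ⊗ₖ ρ₁) ≤ ε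

/-- `Ext` is a `(k₁, k₂, ε)` `X₁`-strong two-source extractor against quantum product-type
knowledge: for all cq-states `ρ_{X₁C₁}`, `ρ_{X₂C₂}` with `H_min(X₁|C₁) ≥ k₁` and
`H_min(X₂|C₂) ≥ k₂`, the state `ρ_{X₁X₂C} = ρ_{X₁C₁} ⊗ ρ_{X₂C₂}`, where `C = C₁C₂`, satisfies
`δ(ρ_{Ext(X₁,X₂) X₁ C}, ω_m ⊗ ρ_{X₁C}) ≤ ε`. -/
def IsX1StrongExtractorAgainstQuantumProduct {n₁ n₂ m : ℕ} (k₁ k₂ ε : ℝ)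
    (Ext : BitString n₁ → BitString n₂ → BitString m) : Prop :=
  ∀ (C₁ C₂ : Type u) [Fintype C₁] [DecidableEq C₁] [Fintype C₂] [DecidableEq C₂]
    (ρ₁ : Matrix (BitString n₁ × C₁) (BitString n₁ × C₁) ℂ)
    (ρ₂ : Matrix (BitString n₂ × C₂) (BitString n₂ × C₂) ℂ),
    IsCQState ρ₁ → IsCQState ρ₂ →
    (k₁ : EReal) ≤ condMinEntropy ρ₁ → (k₂ : EReal) ≤ condMinEntropy ρ₂ →
    traceDistance
      (applyFunctionLeft (fun x : BitString n₁ × BitString n₂ => (Ext x.1 x.2, x.1))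
        (productState ρ₁ ρ₂))
      ((maximallyMixed (BitString m) ⊗ₖ applyFunctionLeft Prod.fst (productState ρ₁ ρ₂)).submatrix
        (Equiv.prodAssoc (BitString m) (BitString n₁) (C₁ × C₂))
        (Equiv.prodAssoc (BitString m) (BitString n₁) (C₁ × C₂))) ≤ ε

end

/-! ### Trace norm inequalities for Hermitian operators. -/

section OperatorLemmas

set_option linter.unusedSectionVars false

/-! Conditioned on `X₁ = x` and output `z`, the deviation from the ideal state is `ρ₁ˣ ⊗ D`, where
`D = ∑ y, deviation x z y • σ y` and `σ y` is the unnormalised state of `C₂` given `y`. Thus `C₁`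
enters only through `p x = tr ρ₁ˣ ≤ 2^(-k₁)`, and it remains to bound the `p`-average of `∑ z ‖D‖₁`
(`ExtractsFrom.sum_traceNorm_le`).

A weighted Cauchy–Schwarz inequality (`traceNorm_sq_le`) replaces `‖D‖₁²` by `2 tr (R⁻¹ D R⁻¹ D)`,
with `R²` a full-rank perturbation of `∑ y, σ y`. Expanding `D` gives the weights `Q y' y = tr (R⁻¹
σ y' R⁻¹ σ y)`: the joint law, of mass at most one, of the outcome `y'` of a pretty good measurement
on `C₂` and the value `y`. The side information has become classical.

Given `y'`, the classical extractor property applies unless `y` has conditional min-entropy below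
`k₂`. The extra `log (1/ε)` of min-entropy makes such `y'` have mass at most `ε`
(`ExtractsFrom.sum_deviation_mul_deviation_le`). Both cases contribute `ε`, and Cauchy–Schwarz over
`(x, z)` yields the factor `√(2^m)`. -/

open scoped MatrixOrder in
lemma Matrix.PosSemidef.exists_mul_self_eq {A : Type*} [Fintype A] [DecidableEq A]
    {M : Matrix A A ℂ} (hM : M.PosSemidef) : ∃ R : Matrix A A ℂ, R.PosSemidef ∧ R * R = M :=
  ⟨CFC.sqrt M, Matrix.nonneg_iff_posSemidef.1 (CFC.sqrt_nonneg M),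
    CFC.sqrt_mul_sqrt_self M (Matrix.nonneg_iff_posSemidef.2 hM)⟩

variable {A : Type*} [Fintype A] [DecidableEq A]

lemma Matrix.PosSemidef.trace_re_nonneg {M : Matrix A A ℂ} (hM : M.PosSemidef) :
    0 ≤ M.trace.re :=
  (Complex.nonneg_iff.1 hM.trace_nonneg).1

lemma Matrix.PosSemidef.trace_eq_re {M : Matrix A A ℂ} (hM : M.PosSemidef) :
    M.trace = (M.trace.re : ℂ) := by
  have := (Complex.nonneg_iff.1 hM.trace_nonneg).2
  apply Complex.ext <;> simp [← this]

/-- The trace of a product of positive semi-definite operators is nonnegative. -/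
lemma Matrix.PosSemidef.trace_mul_nonneg {M N : Matrix A A ℂ} (hM : M.PosSemidef)
    (hN : N.PosSemidef) : 0 ≤ (M * N).trace := by
  obtain ⟨R, hR, rfl⟩ := hM.exists_mul_self_eq
  have h := (hN.conjTranspose_mul_mul_same R).trace_nonneg
  rwa [hR.isHermitian.eq, Matrix.mul_assoc, Matrix.trace_mul_comm, Matrix.mul_assoc,
    Matrix.trace_mul_comm] at h

lemma cfc_posSemidef {M : Matrix A A ℂ} {f : ℝ → ℝ} (hf : ∀ x, 0 ≤ f x) :
    (cfc f M).PosSemidef := by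
  open scoped MatrixOrder in
  exact Matrix.nonneg_iff_posSemidef.1 (cfc_nonneg fun x _ => hf x)

lemma continuousOn_spectrum_real (M : Matrix A A ℂ) (f : ℝ → ℝ) :
    ContinuousOn f (spectrum ℝ M) := by
  have : (spectrum ℝ M).Finite := Matrix.finite_real_spectrum
  exact this.continuousOn f

lemma traceNorm_eq_trace_cfc_abs {M : Matrix A A ℂ} (hM : M.IsHermitian) :
    traceNorm M = (cfc (fun x : ℝ => |x|) M).trace.re := by
  have h : cfc Real.sqrt (M.conjTranspose * M) = cfc (fun x : ℝ => |x|) M := by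
    have h2 : M.conjTranspose * M = cfc (fun x : ℝ => x * x) M := by
      rw [hM.eq, cfc_mul (fun x : ℝ => x) (fun x : ℝ => x) M (continuousOn_spectrum_real _ _)
        (continuousOn_spectrum_real _ _), cfc_id' ℝ M hM.isSelfAdjoint]
    rw [h2, ← cfc_comp' Real.sqrt (fun x : ℝ => x * x) M
      (Real.continuous_sqrt.continuousOn) (continuousOn_spectrum_real _ _) hM.isSelfAdjoint]
    simp only [Real.sqrt_mul_self_eq_abs]
  rw [traceNorm, h]

/-- Jordan decomposition of a Hermitian operator. -/
lemma exists_posSemidef_sub_of_isHermitian {M : Matrix A A ℂ} (hM : M.IsHermitian) :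
    ∃ P N : Matrix A A ℂ, P.PosSemidef ∧ N.PosSemidef ∧ M = P - N ∧
      traceNorm M = P.trace.re + N.trace.re := by
  refine ⟨cfc (fun x : ℝ => max x 0) M, cfc (fun x : ℝ => max (-x) 0) M,
    cfc_posSemidef fun x => le_max_right _ _, cfc_posSemidef fun x => le_max_right _ _, ?_, ?_⟩
  · rw [← cfc_sub _ _ M (continuousOn_spectrum_real _ _) (continuousOn_spectrum_real _ _)]
    conv_lhs => rw [← cfc_id' ℝ M hM.isSelfAdjoint]
    congr 1
    ext x
    rcases le_total 0 x with h | h <;> simp [h]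
  · rw [traceNorm_eq_trace_cfc_abs hM, ← Complex.add_re, ← Matrix.trace_add,
      ← cfc_add M _ _ (continuousOn_spectrum_real _ _) (continuousOn_spectrum_real _ _)]
    congr 3
    ext x
    rcases le_total 0 x with h | h <;> simp [h, abs_of_nonneg, abs_of_nonpos]

/-- The sign of a Hermitian operator attains its trace norm. -/
lemma exists_sign_of_isHermitian {M : Matrix A A ℂ} (hM : M.IsHermitian) :
    ∃ S : Matrix A A ℂ, S.IsHermitian ∧ S * S = 1 ∧ traceNorm M = (S * M).trace.re := by
  -- The value at `0` is `1` rather than `0`, so that the sign squares to the identity even when `M`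
  -- is singular.
  let s : ℝ → ℝ := fun x => if 0 ≤ x then 1 else -1
  refine ⟨cfc s M, cfc_predicate (p := IsSelfAdjoint) s M, ?_, ?_⟩
  · rw [← cfc_mul s s M (continuousOn_spectrum_real _ _) (continuousOn_spectrum_real _ _),
      ← cfc_one ℝ M hM.isSelfAdjoint]
    congr 1
    ext x
    by_cases h : 0 ≤ x <;> simp [s, h]
  · rw [traceNorm_eq_trace_cfc_abs hM]
    have : cfc s M * M = cfc (fun x => s x * x) M := by
      rw [cfc_mul s (fun x => x) M (continuousOn_spectrum_real _ _)
        (continuousOn_spectrum_real _ _), cfc_id' ℝ M hM.isSelfAdjoint]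
    rw [this]
    congr 3
    ext x
    by_cases h : 0 ≤ x
    · simp [s, h, abs_of_nonneg]
    · simp [s, h, abs_of_neg (not_le.1 h)]

/-- Since `(1 - S)² = 2 (1 - S)`, conjugating `P` by `1 - S` gives a positive operator of trace `2
tr P - 2 tr (S P)`. -/
lemma trace_sign_mul_le {S P : Matrix A A ℂ} (hS : S.IsHermitian) (hSS : S * S = 1)
    (hP : P.PosSemidef) : (S * P).trace.re ≤ P.trace.re := by
  have h := (hP.conjTranspose_mul_mul_same (1 - S)).trace_re_nonneg
  have e : ((1 - S).conjTranspose * P * (1 - S)).trace = 2 * P.trace - 2 * (S * P).trace := by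
    rw [Matrix.trace_mul_comm, ← Matrix.mul_assoc, Matrix.conjTranspose_sub, hS.eq,
      Matrix.conjTranspose_one]
    have : (1 - S) * (1 - S) = (2 : ℂ) • (1 - S) := by
      rw [two_smul, sub_mul, mul_sub, mul_sub, hSS, one_mul, one_mul, mul_one]; abel
    rw [this]
    simp [Matrix.sub_mul, mul_sub]
  rw [e] at h
  simp at h
  linarith

lemma traceNorm_sub_le {P N : Matrix A A ℂ} (hP : P.PosSemidef) (hN : N.PosSemidef) :
    traceNorm (P - N) ≤ P.trace.re + N.trace.re := by
  obtain ⟨S, hS, hSS, h⟩ := exists_sign_of_isHermitian (hP.isHermitian.sub hN.isHermitian)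
  have h1 := trace_sign_mul_le hS hSS hP
  have h2 := trace_sign_mul_le hS.neg (by simpa using hSS) hN
  rw [h, Matrix.mul_sub, Matrix.trace_sub, Complex.sub_re]
  rw [Matrix.neg_mul, Matrix.trace_neg, Complex.neg_re] at h2
  linarith

lemma sum_abs_diag_le_traceNorm {M : Matrix A A ℂ} (hM : M.IsHermitian) :
    ∑ i, |(M i i).re| ≤ traceNorm M := by
  obtain ⟨P, N, hP, hN, h, ht⟩ := exists_posSemidef_sub_of_isHermitian hM
  rw [ht, Matrix.trace, Matrix.trace, Complex.re_sum, Complex.re_sum, ← Finset.sum_add_distrib]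
  refine Finset.sum_le_sum fun i _ => ?_
  have h1 := (Complex.nonneg_iff.1 (hP.diag_nonneg (i := i))).1
  have h2 := (Complex.nonneg_iff.1 (hN.diag_nonneg (i := i))).1
  simp only [h, Matrix.sub_apply, Complex.sub_re, Matrix.diag_apply]
  rw [abs_le]
  constructor <;> linarith

/-- Cauchy–Schwarz for the trace norm: `‖M‖₁² ≤ tr R² · tr (R⁻¹ M R⁻¹ M)`. -/
lemma traceNorm_sq_le {M R : Matrix A A ℂ} (hM : M.IsHermitian) (hR : R.PosDef) :
    0 ≤ (R⁻¹ * M * R⁻¹ * M).trace.re ∧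
    traceNorm M ^ 2 ≤ (R * R).trace.re * (R⁻¹ * M * R⁻¹ * M).trace.re := by
  obtain ⟨S, hS, hSS, h⟩ := exists_sign_of_isHermitian hM
  have hu : IsUnit R.det := (Matrix.isUnit_iff_isUnit_det R).1 hR.isUnit
  -- The form `⟨A, B⟩ = tr (A R B R)` is positive on Hermitian operators. Here `⟨S, K⟩ = ‖M‖₁` and
  -- `⟨K, K⟩ = tr (K M)`, so the claim is its Cauchy–Schwarz inequality for `S` and `K`.
  set K := R⁻¹ * M * R⁻¹ with hK
  have hRi : R⁻¹.IsHermitian := hR.inv.isHermitian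
  have hKh : K.IsHermitian := by
    unfold Matrix.IsHermitian
    simp only [hK, Matrix.conjTranspose_mul, hRi.eq, hM.eq, Matrix.mul_assoc]
  have hRKR : R * K * R = M := by
    rw [hK, Matrix.mul_assoc, Matrix.mul_assoc, Matrix.nonsing_inv_mul _ hu, Matrix.mul_one,
      ← Matrix.mul_assoc, Matrix.mul_nonsing_inv _ hu, Matrix.one_mul]
  have form_nonneg : ∀ N : Matrix A A ℂ, N.IsHermitian → 0 ≤ (N * R * N * R).trace.re := by
    intro N hN
    have h1 := hR.posSemidef.conjTranspose_mul_mul_same N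
    rw [hN.eq] at h1
    exact (Complex.nonneg_iff.1 (h1.trace_mul_nonneg hR.posSemidef)).1
  have hKM : (K * M).trace = (K * R * K * R).trace := by
    conv_lhs => rw [← hRKR]
    simp only [Matrix.mul_assoc]
  have hSM : (S * M).trace = (S * R * K * R).trace := by
    rw [← hRKR]; simp only [Matrix.mul_assoc]
  have hKS : (K * R * S * R).trace = (S * R * K * R).trace := by
    rw [Matrix.mul_assoc, Matrix.trace_mul_comm, ← Matrix.mul_assoc]
  -- The squared Hilbert–Schmidt norm of the commutator of `S` and `R` is `2 tr R² - 2 tr (S R S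
  -- R)`.
  have hSR : (S * R * S * R).trace.re ≤ (R * R).trace.re := by
    have hp := (Matrix.posSemidef_conjTranspose_mul_self (S * R - R * S)).trace_re_nonneg
    rw [Matrix.conjTranspose_sub, Matrix.conjTranspose_mul, Matrix.conjTranspose_mul, hS.eq,
      hR.isHermitian.eq] at hp
    have e1 : (R * S * (S * R)).trace = (R * R).trace := by
      rw [Matrix.mul_assoc, ← Matrix.mul_assoc S, hSS, Matrix.one_mul]
    have e2 : (S * R * (R * S)).trace = (R * R).trace := by
      rw [Matrix.trace_mul_comm]; exact e1
    have e3 : (R * S * (R * S)).trace = (S * R * S * R).trace := by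
      rw [Matrix.mul_assoc, Matrix.trace_mul_comm]; simp only [Matrix.mul_assoc]
    have e4 : (S * R * (S * R)).trace = (S * R * S * R).trace := by
      simp only [Matrix.mul_assoc]
    rw [Matrix.sub_mul, Matrix.mul_sub, Matrix.mul_sub, Matrix.trace_sub, Matrix.trace_sub,
      Matrix.trace_sub, e1, e2, e3, e4] at hp
    simp only [Complex.sub_re] at hp
    linarith
  -- This is `⟨S - tK, S - tK⟩ ≥ 0` with `⟨S, S⟩` enlarged to `tr R²`; the discriminant then gives
  -- the bound.
  have key : ∀ t : ℝ, 0 ≤ (K * M).trace.re * (t * t) + (-2 * traceNorm M) * t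
      + (R * R).trace.re := by
    intro t
    have hp := form_nonneg (S - (t : ℂ) • K) (hS.sub (by
      unfold Matrix.IsHermitian
      rw [Matrix.conjTranspose_smul, hKh.eq]; simp))
    simp only [Matrix.sub_mul, Matrix.mul_sub, Matrix.smul_mul, Matrix.mul_smul,
      Matrix.trace_sub, Matrix.trace_smul, Complex.sub_re, smul_eq_mul, Complex.re_ofReal_mul,
      hKS, ← hKM, ← hSM, ← h] at hp
    linarith
  refine ⟨hKM ▸ form_nonneg K hKh, ?_⟩
  have := discrim_le_zero key
  rw [discrim] at this
  linarith

end OperatorLemmas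

/-! ### Classical side information: the collision-type bound. -/

section Extraction

set_option linter.unusedSectionVars false

/-- The deviation `1[E x y = z] - 1 / |Z|` of the output of `E` from the uniform distribution. -/
noncomputable def deviation {X Y Z : Type*} [Fintype Z] [DecidableEq Z] (E : X → Y → Z) (x : X) (z : Z) (y : Y) :
    ℝ :=
  (if E x y = z then 1 else 0) - (Fintype.card Z : ℝ)⁻¹

variable {X Y Z : Type*} [Fintype X] [Fintype Y] [Fintype Z] [DecidableEq Z]

/-- Distributions on `Y` bounded by `b` are mapped by `E` close to uniform, given a seed of
distribution `p`. -/
def ExtractsFrom (E : X → Y → Z) (p : X → ℝ) (b ε : ℝ) : Prop :=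
  ∀ q : Y → ℝ, (∀ y, 0 ≤ q y) → ∑ y, q y = 1 → (∀ y, q y ≤ b) →
    ∑ x, p x * ∑ z, |∑ y, deviation E x z y * q y| ≤ 2 * ε

lemma sum_deviation (E : X → Y → Z) (x : X) (y : Y) : ∑ z, deviation E x z y = 0 := by
  have : (Fintype.card Z : ℝ) ≠ 0 := by
    have : Nonempty Z := ⟨E x y⟩
    exact_mod_cast Fintype.card_ne_zero
  simp [deviation, Finset.sum_sub_distrib, this]

lemma abs_deviation_le_one (E : X → Y → Z) (x : X) (z : Z) (y : Y) :
    |deviation E x z y| ≤ 1 := by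
  have h1 : (Fintype.card Z : ℝ)⁻¹ ≤ 1 := Nat.cast_inv_le_one _
  have h2 : 0 ≤ (Fintype.card Z : ℝ)⁻¹ := by positivity
  unfold deviation
  split_ifs <;> rw [abs_le] <;> constructor <;> linarith

/-- The positive and negative parts of a zero-sum family have equal mass. This turns the `2 * ε` of
`ExtractsFrom` into `ε` for a single output. -/
lemma le_half_sum_abs {d : Z → ℝ} (h : ∑ z, d z = 0) (z₀ : Z) :
    d z₀ ≤ (∑ z, |d z|) / 2 := by
  have h1 : ∑ z, (|d z| + d z) = ∑ z, |d z| := by rw [Finset.sum_add_distrib, h, add_zero]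
  have h2 := Finset.single_le_sum (f := fun z => |d z| + d z)
    (fun z _ => by linarith [neg_abs_le (d z)]) (Finset.mem_univ z₀)
  linarith [le_abs_self (d z₀)]

/-- The constant part of the first deviation is killed because deviations sum to zero over `z`; only
`z = E x y'` survives. -/
lemma sum_deviation_mul (E : X → Y → Z) (x : X) (y' : Y) (q : Y → ℝ) :
    ∑ z, deviation E x z y' * ∑ y, deviation E x z y * q y
      = ∑ y, deviation E x (E x y') y * q y := by
  have h0 : ∑ z, ∑ y, deviation E x z y * q y = 0 := by
    rw [Finset.sum_comm]
    simp [← Finset.sum_mul, sum_deviation]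
  have : ∀ z, deviation E x z y' * ∑ y, deviation E x z y * q y
      = (if E x y' = z then ∑ y, deviation E x z y * q y else 0)
        - (Fintype.card Z : ℝ)⁻¹ * ∑ y, deviation E x z y * q y := by
    intro z
    conv_lhs => rw [deviation, sub_mul]
    simp
  simp_rw [this]
  rw [Finset.sum_sub_distrib, ← Finset.mul_sum, h0]
  simp

lemma sum_deviation_mul_le_sum (E : X → Y → Z) (x : X) (z : Z) {q : Y → ℝ} (hq : ∀ y, 0 ≤ q y) :
    ∑ y, deviation E x z y * q y ≤ ∑ y, q y :=
  Finset.sum_le_sum fun y _ => by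
    have := (abs_le.1 (abs_deviation_le_one E x z y)).2
    nlinarith [hq y]

/-- Normalising `q` gives an admissible source. Guessing the output to be `E x y'` is then a test
whose advantage over uniform is at most `ε`. -/
lemma ExtractsFrom.sum_deviation_mul_le {E : X → Y → Z} {p : X → ℝ} {b ε : ℝ}
    (h : ExtractsFrom E p b ε) (hp : ∀ x, 0 ≤ p x) {q : Y → ℝ} (hq : ∀ y, 0 ≤ q y)
    (hb : ∀ y, q y ≤ b * ∑ y, q y) (y' : Y) :
    ∑ x, p x * ∑ y, deviation E x (E x y') y * q y ≤ ε * ∑ y, q y := by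
  rcases (Finset.sum_nonneg fun y _ => hq y).eq_or_lt' with h0 | h0
  · have : ∀ y, q y = 0 := fun y =>
      (Finset.sum_eq_zero_iff_of_nonneg fun y _ => hq y).1 h0 y (Finset.mem_univ y)
    simp [this]
  set s := ∑ y, q y with hs
  have h1 := h (fun y => q y / s) (fun y => div_nonneg (hq y) h0.le)
    (by rw [← Finset.sum_div, div_self h0.ne']) (fun y => (div_le_iff₀ h0).2 (hb y))
  have h2 : ∀ x z, |∑ y, deviation E x z y * (q y / s)|
      = |∑ y, deviation E x z y * q y| / s := by
    intro x z
    rw [show |∑ y, deviation E x z y * q y| / s = |∑ y, deviation E x z y * q y| / |s| by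
      rw [abs_of_pos h0], ← abs_div, Finset.sum_div]
    simp only [mul_div_assoc]
  simp only [h2] at h1
  simp only [← Finset.sum_div, mul_div_assoc'] at h1
  rw [div_le_iff₀ h0] at h1
  have h3 : ∑ x, p x * ∑ y, deviation E x (E x y') y * q y
      ≤ ∑ x, p x * ((∑ z, |∑ y, deviation E x z y * q y|) / 2) := by
    refine Finset.sum_le_sum fun x _ => mul_le_mul_of_nonneg_left ?_ (hp x)
    refine le_half_sum_abs (d := fun z => ∑ y, deviation E x z y * q y) ?_ _
    rw [Finset.sum_comm]
    simp [← Finset.sum_mul, sum_deviation]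
  simp only [mul_div_assoc', ← Finset.sum_div] at h3
  linarith

/-- Collision-type bound for classical side information `y'`, jointly distributed with `y`
according to `Q`. -/
lemma ExtractsFrom.sum_deviation_mul_deviation_le {E : X → Y → Z} {p : X → ℝ} {k ε : ℝ}
    (h : ExtractsFrom E p (2 ^ (-k)) ε) (hε : 0 < ε) (hp : ∀ x, 0 ≤ p x) (hp1 : ∑ x, p x = 1)
    {Q : Y → Y → ℝ} (hQ : ∀ y' y, 0 ≤ Q y' y) (hQ1 : ∑ y', ∑ y, Q y' y ≤ 1)
    (hguess : ∀ r : ℝ, r < k + Real.logb 2 (1 / ε) → ∃ w : Y → ℝ, (∀ y, 0 ≤ w y) ∧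
      ∑ y, w y ≤ 1 ∧ ∀ y' y, Q y' y ≤ 2 ^ (-r) * w y') :
    ∑ x, p x * ∑ z, ∑ y', ∑ y, deviation E x z y' * deviation E x z y * Q y' y ≤ 2 * ε := by
  classical
  -- Those `y'` given which `y` still has conditional min-entropy at least `k`.
  let good : Y → Prop := fun y' => ∀ y, Q y' y ≤ 2 ^ (-k) * ∑ y, Q y' y
  have hbad : ∑ y', (if good y' then 0 else ∑ y, Q y' y) ≤ ε := by
    have hr : ∀ r : ℝ, r < k + Real.logb 2 (1 / ε) →
        ∑ y', (if good y' then 0 else ∑ y, Q y' y) ≤ 2 ^ (k - r) := by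
      intro r hr
      obtain ⟨w, hw, hw1, hQw⟩ := hguess r hr
      calc ∑ y', (if good y' then 0 else ∑ y, Q y' y) ≤ ∑ y', 2 ^ (k - r) * w y' := by
            refine Finset.sum_le_sum fun y' _ => ?_
            split_ifs with hg
            · exact mul_nonneg (by positivity) (hw y')
            · simp only [good, not_forall, not_le] at hg
              obtain ⟨y, hy⟩ := hg
              -- A bad `y'` has a likely `y`: its mass is less than `2^k * Q y' y`, and `Q y' y ≤
              -- 2^(-r) * w y'`.
              have h1 := hy.trans_le (hQw y' y)
              have h2 : (0 : ℝ) < 2 ^ k := by positivity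
              have h3 := mul_le_mul_of_nonneg_left h1.le h2.le
              rw [← mul_assoc, ← mul_assoc, ← Real.rpow_add two_pos, ← Real.rpow_add two_pos] at h3
              simpa [sub_eq_add_neg] using h3
        _ = 2 ^ (k - r) * ∑ y', w y' := by rw [Finset.mul_sum]
        _ ≤ 2 ^ (k - r) := mul_le_of_le_one_right (by positivity) hw1
    -- The guessing bound is available only for `r` strictly below the threshold; letting `r` tend
    -- to it gives `2^(k - r) → ε`.
    have hcont : Continuous fun r : ℝ => (2 : ℝ) ^ (k - r) :=
      (Real.continuous_const_rpow two_ne_zero).comp (continuous_const.sub continuous_id)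
    have hlim := ge_of_tendsto
      ((hcont.tendsto (k + Real.logb 2 (1 / ε))).mono_left
        (nhdsWithin_le_nhds (s := Set.Iio _)))
      (Filter.eventually_of_mem self_mem_nhdsWithin fun r hr' => hr r hr')
    have he : (2 : ℝ) ^ (k - (k + Real.logb 2 (1 / ε))) = ε := by
      rw [one_div, Real.logb_inv, show k - (k + -Real.logb 2 ε) = Real.logb 2 ε by ring,
        Real.rpow_logb two_pos (by norm_num) hε]
    rwa [he] at hlim
  -- A good `y'` costs `ε` times its mass, a bad one at most its whole mass.
  have hterm : ∀ y', ∑ x, p x * ∑ y, deviation E x (E x y') y * Q y' y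
      ≤ ε * ∑ y, Q y' y + if good y' then 0 else ∑ y, Q y' y := by
    intro y'
    split_ifs with hg
    · rw [add_zero]
      exact h.sum_deviation_mul_le hp (hQ y') hg y'
    · have h1 : ∑ x, p x * ∑ y, deviation E x (E x y') y * Q y' y ≤ ∑ x, p x * ∑ y, Q y' y :=
        Finset.sum_le_sum fun x _ =>
          mul_le_mul_of_nonneg_left (sum_deviation_mul_le_sum E x _ (hQ y')) (hp x)
      rw [← Finset.sum_mul, hp1, one_mul] at h1
      have := mul_nonneg hε.le (Finset.sum_nonneg fun y (_ : y ∈ Finset.univ) => hQ y' y)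
      linarith
  have heq : ∑ x, p x * ∑ z, ∑ y', ∑ y, deviation E x z y' * deviation E x z y * Q y' y
      = ∑ y', ∑ x, p x * ∑ y, deviation E x (E x y') y * Q y' y := by
    rw [Finset.sum_comm]
    refine Finset.sum_congr rfl fun x _ => ?_
    rw [← Finset.mul_sum, Finset.sum_comm]
    congr 1
    refine Finset.sum_congr rfl fun y' _ => ?_
    rw [← sum_deviation_mul]
    simp only [Finset.mul_sum, mul_assoc]
  rw [heq]
  calc _ ≤ ∑ y', (ε * ∑ y, Q y' y + if good y' then 0 else ∑ y, Q y' y) :=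
        Finset.sum_le_sum fun y' _ => hterm y'
    _ = ε * ∑ y', ∑ y, Q y' y + ∑ y', (if good y' then 0 else ∑ y, Q y' y) := by
        rw [Finset.sum_add_distrib, Finset.mul_sum]
    _ ≤ 2 * ε := by nlinarith

/-! ### Quantum side information through a pretty good measurement. -/

variable {C : Type*} [Fintype C] [DecidableEq C]

/-- The square root of a full-rank perturbation of a state, whose inverse defines a
pretty good measurement. -/
lemma exists_posDef_sqrt_perturbation {s : Matrix C C ℂ} (hs : s.PosSemidef)
    (ht : s.trace = 1) :
    ∃ R : Matrix C C ℂ, R.PosDef ∧ (R * R).trace.re = 2 ∧ (1 - R⁻¹ * s * R⁻¹).PosSemidef := by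
  have hC : Nonempty C := by
    by_contra hC
    rw [not_nonempty_iff] at hC
    simp [Matrix.trace] at ht
  have hd : (0 : ℝ) < Fintype.card C := by exact_mod_cast Fintype.card_pos
  have hd' : (0 : ℂ) < (Fintype.card C : ℂ)⁻¹ := by
    have : (0 : ℝ) < (Fintype.card C : ℝ)⁻¹ := by positivity
    have h := Complex.zero_lt_real.2 this
    push_cast at h
    exact h
  -- Adding the maximally mixed state makes the operator invertible and raises its trace to `2`, a
  -- loss that the final constant accommodates exactly.
  have hT : (s + (Fintype.card C : ℂ)⁻¹ • (1 : Matrix C C ℂ)).PosDef :=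
    Matrix.PosDef.posSemidef_add hs (Matrix.PosDef.one.smul hd')
  obtain ⟨R, hR, hRR⟩ := hT.posSemidef.exists_mul_self_eq
  have hRu : IsUnit R := by
    have := hT.isUnit
    rw [← hRR] at this
    exact isUnit_of_mul_isUnit_left this
  have hRd := (Matrix.isUnit_iff_isUnit_det R).1 hRu
  have hRp : R.PosDef := (hR.posDef_iff_isUnit).2 hRu
  refine ⟨R, hRp, ?_, ?_⟩
  · rw [hRR, Matrix.trace_add, ht, Matrix.trace_smul, Matrix.trace_one, smul_eq_mul,
      inv_mul_cancel₀ (by exact_mod_cast hd.ne')]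
    norm_num
  · have hse : s = R * R - (Fintype.card C : ℂ)⁻¹ • (1 : Matrix C C ℂ) := by rw [hRR]; simp
    have : 1 - R⁻¹ * s * R⁻¹ = (Fintype.card C : ℂ)⁻¹ • (R⁻¹ * R⁻¹) := by
      rw [hse, Matrix.mul_sub, Matrix.sub_mul, ← Matrix.mul_assoc, Matrix.nonsing_inv_mul _ hRd,
        Matrix.one_mul, Matrix.mul_nonsing_inv _ hRd]
      simp
    rw [this]
    refine Matrix.PosSemidef.smul ?_ hd'.le
    have h2 := Matrix.posSemidef_conjTranspose_mul_self R⁻¹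
    rwa [hRp.inv.isHermitian.eq] at h2

lemma trace_mul_re_le_of_sub_posSemidef {M N P : Matrix C C ℂ} (hP : P.PosSemidef)
    (h : (N - M).PosSemidef) : (P * M).trace.re ≤ (P * N).trace.re := by
  have := (Complex.nonneg_iff.1 (hP.trace_mul_nonneg h)).1
  rw [Matrix.mul_sub, Matrix.trace_sub, Complex.sub_re] at this
  linarith

lemma Matrix.isHermitian_sum_real_smul {σ : Y → Matrix C C ℂ} (hσ : ∀ y, (σ y).IsHermitian)
    (c : Y → ℝ) : (∑ y, (c y : ℂ) • σ y).IsHermitian := by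
  unfold Matrix.IsHermitian
  rw [Matrix.conjTranspose_sum]
  refine Finset.sum_congr rfl fun y _ => ?_
  rw [Matrix.conjTranspose_smul, (hσ y).eq]
  simp

/-- An extractor without side information for the seed distribution `p` extracts in the presence
of quantum side information about the source. -/
theorem ExtractsFrom.sum_traceNorm_le {E : X → Y → Z} {p : X → ℝ} {k ε : ℝ}
    (h : ExtractsFrom E p (2 ^ (-k)) ε) (hε : 0 < ε) (hp : ∀ x, 0 ≤ p x) (hp1 : ∑ x, p x = 1)
    {σ : Y → Matrix C C ℂ} (hσ : ∀ y, (σ y).PosSemidef) (hσ1 : (∑ y, σ y).trace = 1)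
    (hguess : ∀ r : ℝ, r < k + Real.logb 2 (1 / ε) → ∃ τ : Matrix C C ℂ, IsDensityOperator τ ∧
      ∀ y, ((((2 : ℝ) ^ (-r) : ℝ) : ℂ) • τ - σ y).PosSemidef) :
    ∑ x, p x * ∑ z, traceNorm (∑ y, (deviation E x z y : ℂ) • σ y)
      ≤ 2 * Real.sqrt (Fintype.card Z * ε) := by
  have hs : (∑ y, σ y).PosSemidef := Matrix.posSemidef_sum _ fun y _ => hσ y
  obtain ⟨R, hR, hR2, hR1⟩ := exists_posDef_sqrt_perturbation hs hσ1
  have hM : ∀ y, (R⁻¹ * σ y * R⁻¹).PosSemidef := fun y => by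
    have := (hσ y).conjTranspose_mul_mul_same R⁻¹
    rwa [hR.inv.isHermitian.eq] at this
  have hsum : ∑ y, R⁻¹ * σ y * R⁻¹ = R⁻¹ * (∑ y, σ y) * R⁻¹ := by
    rw [Matrix.mul_sum, Matrix.sum_mul]
  have hle : ∀ τ : Matrix C C ℂ, τ.PosSemidef →
      ∑ y, (R⁻¹ * σ y * R⁻¹ * τ).trace.re ≤ τ.trace.re := by
    intro τ hτ
    have h1 := trace_mul_re_le_of_sub_posSemidef hτ hR1
    rw [Matrix.mul_one, Matrix.trace_mul_comm, ← hsum, Matrix.sum_mul, Matrix.trace_sum,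
      Complex.re_sum] at h1
    exact h1
  -- The operators `R⁻¹ * σ y' * R⁻¹` are positive with sum at most `1`, hence a sub-normalised
  -- measurement.
  let Q : Y → Y → ℝ := fun y' y => (R⁻¹ * σ y' * R⁻¹ * σ y).trace.re
  have hQ : ∀ y' y, 0 ≤ Q y' y := fun y' y =>
    (Complex.nonneg_iff.1 ((hM y').trace_mul_nonneg (hσ y))).1
  have hQ1 : ∑ y', ∑ y, Q y' y ≤ 1 := by
    have h1 := hle _ hs
    simp only [hσ1, Matrix.mul_sum, Matrix.trace_sum, Complex.re_sum, Complex.one_re] at h1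
    exact h1
  have key := h.sum_deviation_mul_deviation_le hε hp hp1 hQ hQ1 (by
    intro r hr
    obtain ⟨τ, hτ, hτσ⟩ := hguess r hr
    -- The weight `w` consists of the outcome probabilities of the same measurement on `τ`; pairing
    -- `σ y ≤ 2^(-r) τ` with a measurement operator gives the bound on `Q`.
    refine ⟨fun y => (R⁻¹ * σ y * R⁻¹ * τ).trace.re, fun y =>
      (Complex.nonneg_iff.1 ((hM y).trace_mul_nonneg hτ.1)).1, ?_, fun y' y => ?_⟩
    · simpa [hτ.2] using hle τ hτ.1
    · have h1 := trace_mul_re_le_of_sub_posSemidef (hM y') (hτσ y)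
      rwa [Matrix.mul_smul, Matrix.trace_smul, smul_eq_mul, Complex.re_ofReal_mul] at h1)
  let t : X → Z → ℝ := fun x z =>
    ∑ y', ∑ y, deviation E x z y' * deviation E x z y * Q y' y
  have ht : ∀ x z, t x z = (R⁻¹ * (∑ y, (deviation E x z y : ℂ) • σ y) * R⁻¹ *
      (∑ y, (deviation E x z y : ℂ) • σ y)).trace.re := by
    intro x z
    simp only [t, Q, Matrix.mul_sum, Matrix.sum_mul, Matrix.trace_sum, Complex.re_sum,
      Matrix.mul_smul, Matrix.smul_mul, Matrix.trace_smul, smul_eq_mul, Complex.re_ofReal_mul]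
    rw [Finset.sum_comm]
    refine Finset.sum_congr rfl fun y _ => ?_
    rw [Finset.mul_sum]
    refine Finset.sum_congr rfl fun y' _ => ?_
    ring
  have hCS := fun x z => traceNorm_sq_le (R := R)
    (Matrix.isHermitian_sum_real_smul (fun y => (hσ y).isHermitian) (deviation E x z)) hR
  simp only [← ht, hR2] at hCS
  have hN : ∀ x z, traceNorm (∑ y, (deviation E x z y : ℂ) • σ y) ≤ Real.sqrt (2 * t x z) :=
    fun x z => Real.le_sqrt_of_sq_le (hCS x z).2
  calc _ ≤ ∑ x, p x * ∑ z, Real.sqrt (2 * t x z) := by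
        refine Finset.sum_le_sum fun x _ => mul_le_mul_of_nonneg_left ?_ (hp x)
        exact Finset.sum_le_sum fun z _ => hN x z
    -- Splitting off `√(p x)` prepares Cauchy–Schwarz over pairs `(x, z)`, where the total weight is
    -- `|Z|` because `p` sums to one.
    _ = ∑ i : X × Z, Real.sqrt (p i.1) * Real.sqrt (p i.1 * (2 * t i.1 i.2)) := by
        rw [Fintype.sum_prod_type]
        refine Finset.sum_congr rfl fun x _ => ?_
        rw [Finset.mul_sum]
        refine Finset.sum_congr rfl fun z _ => ?_
        rw [Real.sqrt_mul (hp x), ← mul_assoc, Real.mul_self_sqrt (hp x)]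
    _ ≤ Real.sqrt (∑ i : X × Z, p i.1) * Real.sqrt (∑ i : X × Z, p i.1 * (2 * t i.1 i.2)) :=
        Real.sum_sqrt_mul_sqrt_le _ (fun i => hp i.1)
          (fun i => mul_nonneg (hp i.1) (mul_nonneg two_pos.le (hCS i.1 i.2).1))
    _ = Real.sqrt (Fintype.card Z) * Real.sqrt (2 * ∑ x, p x * ∑ z, t x z) := by
        rw [Fintype.sum_prod_type, Fintype.sum_prod_type]
        simp only [Finset.sum_const, Finset.card_univ, nsmul_eq_mul, ← Finset.mul_sum, hp1,
          mul_one]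
        simp only [Finset.mul_sum]
        simp only [mul_left_comm]
    _ ≤ Real.sqrt (Fintype.card Z) * Real.sqrt (2 * (2 * ε)) := by gcongr
    _ = 2 * Real.sqrt (Fintype.card Z * ε) := by
        rw [Real.sqrt_mul (Nat.cast_nonneg _), show 2 * (2 * ε) = 2 ^ 2 * ε by ring,
          Real.sqrt_mul (by positivity), Real.sqrt_sq two_pos.le]
        ring

end Extraction

/-! ### Block structure of classical-quantum states and consequences of min-entropy bounds. -/

section States

set_option linter.unusedSectionVars false

variable {A B X Y C : Type*} [Fintype A] [DecidableEq A] [Fintype B] [DecidableEq B]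
  [Fintype X] [DecidableEq X] [Fintype Y] [DecidableEq Y] [Fintype C] [DecidableEq C]

lemma basisProjector_eq_diagonal (a : A) :
    basisProjector a = Matrix.diagonal (fun i => if a = i then (1 : ℂ) else 0) := by
  ext i j
  simp only [basisProjector, Matrix.single_apply, Matrix.diagonal_apply]
  aesop

lemma basisProjector_posSemidef (a : A) : (basisProjector a).PosSemidef := by
  rw [basisProjector_eq_diagonal, Matrix.posSemidef_diagonal_iff]
  intro i
  split_ifs <;> simp

lemma trace_basisProjector (a : A) : (basisProjector a).trace = 1 := by
  rw [basisProjector_eq_diagonal, Matrix.trace_diagonal]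
  simp

lemma basisProjector_apply (a i j : A) :
    basisProjector a i j = if a = i ∧ a = j then 1 else 0 := by
  simp [basisProjector, Matrix.single_apply]

lemma sum_smul_basisProjector (P : X → ℝ) :
    ∑ x, (P x : ℂ) • basisProjector x = Matrix.diagonal fun x => (P x : ℂ) := by
  ext i j
  rw [Matrix.sum_apply]
  simp only [Matrix.smul_apply, basisProjector_apply, Matrix.diagonal_apply, smul_eq_mul]
  by_cases h : i = j
  · subst h; simp
  · rw [if_neg h]
    refine Finset.sum_eq_zero fun x _ => ?_
    rw [if_neg (by rintro ⟨rfl, rfl⟩; exact h rfl), mul_zero]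

lemma isClassicalState_diagonal {P : X → ℝ} (hP : ∀ x, 0 ≤ P x) (hP1 : ∑ x, P x = 1) :
    IsClassicalState (Matrix.diagonal fun x => (P x : ℂ)) := by
  refine ⟨⟨Matrix.posSemidef_diagonal_iff.2 fun x => ?_, ?_⟩, P, (sum_smul_basisProjector P).symm⟩
  · exact Complex.zero_le_real.2 (hP x)
  · rw [Matrix.trace_diagonal]
    exact_mod_cast hP1

lemma le_minEntropy_diagonal {P : X → ℝ} {k : ℝ} (h : ∀ x, P x ≤ 2 ^ (-k)) :
    (k : EReal) ≤ minEntropy (Matrix.diagonal fun x => (P x : ℂ)) := by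
  refine le_sSup ⟨k, rfl, ?_⟩
  rw [← Matrix.diagonal_one, ← Matrix.diagonal_smul, Matrix.diagonal_sub,
    Matrix.posSemidef_diagonal_iff]
  intro x
  simp only [Pi.smul_apply, smul_eq_mul, mul_one]
  rw [← Complex.ofReal_sub]
  exact Complex.zero_le_real.2 (sub_nonneg.2 (h x))

lemma applyFunction_eq_diagonal (f : X → Y) (ρ : Matrix X X ℂ) :
    applyFunction f ρ = Matrix.diagonal fun y => ∑ x, if f x = y then ρ x x else 0 := by
  ext i j
  rw [applyFunction, Matrix.sum_apply]
  simp only [Matrix.smul_apply, basisProjector_apply, Matrix.diagonal_apply, smul_eq_mul]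
  by_cases h : i = j
  · subst h; simp
  · rw [if_neg h]
    refine Finset.sum_eq_zero fun x _ => ?_
    rw [if_neg (by rintro ⟨rfl, h'⟩; exact h h'), mul_zero]

lemma applyFunctionLeft_apply (f : X → Y) (ρ : Matrix (X × C) (X × C) ℂ) (i j : Y) (c d : C) :
    applyFunctionLeft f ρ (i, c) (j, d)
      = if i = j then ∑ x, if f x = i then ρ (x, c) (x, d) else 0 else 0 := by
  rw [applyFunctionLeft, Matrix.sum_apply]
  simp only [Matrix.kroneckerMap_apply, basisProjector_apply, Matrix.submatrix_apply]
  by_cases h : i = j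
  · subst h; simp
  · rw [if_neg h]
    refine Finset.sum_eq_zero fun x _ => ?_
    rw [if_neg (by rintro ⟨rfl, h'⟩; exact h h'), zero_mul]

lemma sum_basisProjector_kronecker_apply (D : Y → Matrix C C ℂ) (i j : Y) (c d : C) :
    (∑ y, basisProjector y ⊗ₖ D y) (i, c) (j, d) = if i = j then D i c d else 0 := by
  rw [Matrix.sum_apply]
  simp only [Matrix.kroneckerMap_apply, basisProjector_apply]
  by_cases h : i = j
  · subst h; simp
  · rw [if_neg h]
    refine Finset.sum_eq_zero fun x _ => ?_
    rw [if_neg (by rintro ⟨rfl, h'⟩; exact h h'), zero_mul]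

lemma maximallyMixed_eq_diagonal :
    maximallyMixed A = Matrix.diagonal fun _ => ((Fintype.card A : ℝ)⁻¹ : ℂ) := by
  rw [maximallyMixed, ← Matrix.diagonal_one, ← Matrix.diagonal_smul]
  ext i j
  simp [Matrix.diagonal_apply]

/-- The trace norm of a block-diagonal operator whose blocks are `ρᵢ ⊗ Dᵢ` with `ρᵢ` positive. -/
lemma traceNorm_sum_basisProjector_kronecker_le {ρ : Y → Matrix A A ℂ} {D : Y → Matrix B B ℂ}
    (hρ : ∀ y, (ρ y).PosSemidef) (hD : ∀ y, (D y).IsHermitian) :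
    traceNorm (∑ y, basisProjector y ⊗ₖ (ρ y ⊗ₖ D y))
      ≤ ∑ y, (ρ y).trace.re * traceNorm (D y) := by
  -- Tensoring the Jordan parts of each `D y` with the positive `ρ y` writes the whole operator as a
  -- difference of positive ones with the right traces.
  choose P N hP hN hPN ht using fun y => exists_posSemidef_sub_of_isHermitian (hD y)
  have hpos : ∀ K : Y → Matrix B B ℂ, (∀ y, (K y).PosSemidef) →
      (∑ y, basisProjector y ⊗ₖ (ρ y ⊗ₖ K y)).PosSemidef := fun K hK =>
    Matrix.posSemidef_sum _ fun y _ => (basisProjector_posSemidef y).kronecker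
      ((hρ y).kronecker (hK y))
  have htr : ∀ K : Y → Matrix B B ℂ,
      (∑ y, basisProjector y ⊗ₖ (ρ y ⊗ₖ K y)).trace.re
        = ∑ y, (ρ y).trace.re * (K y).trace.re := by
    intro K
    rw [Matrix.trace_sum, Complex.re_sum]
    refine Finset.sum_congr rfl fun y _ => ?_
    rw [Matrix.trace_kronecker, Matrix.trace_kronecker, trace_basisProjector, one_mul,
      (hρ y).trace_eq_re, Complex.re_ofReal_mul, Complex.ofReal_re]
  have hsub : ∑ y, basisProjector y ⊗ₖ (ρ y ⊗ₖ D y)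
      = ∑ y, basisProjector y ⊗ₖ (ρ y ⊗ₖ P y) - ∑ y, basisProjector y ⊗ₖ (ρ y ⊗ₖ N y) := by
    rw [← Finset.sum_sub_distrib]
    refine Finset.sum_congr rfl fun y _ => ?_
    rw [hPN y]
    ext i j
    simp [Matrix.kroneckerMap_apply, mul_sub]
  rw [hsub]
  refine (traceNorm_sub_le (hpos P hP) (hpos N hN)).trans_eq ?_
  rw [htr, htr, ← Finset.sum_add_distrib]
  refine Finset.sum_congr rfl fun y _ => ?_
  rw [ht y]
  ring

/-- A lower bound on the conditional min-entropy bounds the conditional states of `ρ`. -/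
lemma exists_posSemidef_of_le_condMinEntropy {ρ : Matrix (X × C) (X × C) ℂ} {k : ℝ}
    (h : (k : EReal) ≤ condMinEntropy ρ) {r : ℝ} (hr : r < k) :
    ∃ τ : Matrix C C ℂ, IsDensityOperator τ ∧ ∀ x,
      ((((2 : ℝ) ^ (-r) : ℝ) : ℂ) • τ - ρ.submatrix (Prod.mk x) (Prod.mk x)).PosSemidef := by
  -- The strict inequality `r < k` yields actual witnesses from both suprema without showing that
  -- they are attained.
  have h1 : (r : EReal) < condMinEntropy ρ := (EReal.coe_lt_coe_iff.2 hr).trans_le h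
  obtain ⟨_, ⟨τ, hτ, rfl⟩, h2⟩ := lt_sSup_iff.1 h1
  obtain ⟨_, ⟨r', rfl, h3⟩, h4⟩ := lt_sSup_iff.1 h2
  refine ⟨τ, hτ, fun x => ?_⟩
  have h5 := h3.submatrix (Prod.mk x)
  have h6 : ((((2 : ℝ) ^ (-r') : ℝ) : ℂ) • ((1 : Matrix X X ℂ) ⊗ₖ τ) - ρ).submatrix
      (Prod.mk x) (Prod.mk x)
      = (((2 : ℝ) ^ (-r') : ℝ) : ℂ) • τ - ρ.submatrix (Prod.mk x) (Prod.mk x) := by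
    ext c d
    simp [Matrix.kroneckerMap_apply]
  rw [h6] at h5
  have h7 : (2 : ℝ) ^ (-r') ≤ 2 ^ (-r) :=
    Real.rpow_le_rpow_of_exponent_le one_le_two (neg_le_neg (EReal.coe_lt_coe_iff.1 h4).le)
  have h8 : (0 : ℂ) ≤ (((2 : ℝ) ^ (-r) - 2 ^ (-r') : ℝ) : ℂ) :=
    Complex.zero_le_real.2 (sub_nonneg.2 h7)
  have h9 := (hτ.1.smul h8).add h5
  convert h9 using 1
  rw [Complex.ofReal_sub, sub_smul]
  abel

lemma trace_eq_sum_trace_submatrix (ρ : Matrix (X × C) (X × C) ℂ) :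
    ρ.trace = ∑ x, (ρ.submatrix (Prod.mk x) (Prod.mk x)).trace := by
  simp only [Matrix.trace, Fintype.sum_prod_type, Matrix.diag_apply, Matrix.submatrix_apply]

lemma trace_submatrix_le_of_le_condMinEntropy {ρ : Matrix (X × C) (X × C) ℂ} {k : ℝ}
    (h : (k : EReal) ≤ condMinEntropy ρ) (x : X) :
    (ρ.submatrix (Prod.mk x) (Prod.mk x)).trace.re ≤ 2 ^ (-k) := by
  have hr : ∀ r : ℝ, r < k → (ρ.submatrix (Prod.mk x) (Prod.mk x)).trace.re ≤ 2 ^ (-r) := by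
    intro r hr
    obtain ⟨τ, hτ, hτρ⟩ := exists_posSemidef_of_le_condMinEntropy h hr
    have := (hτρ x).trace_re_nonneg
    rw [Matrix.trace_sub, Matrix.trace_smul, hτ.2, smul_eq_mul, mul_one, Complex.sub_re,
      Complex.ofReal_re] at this
    linarith
  have hcont : Continuous fun r : ℝ => (2 : ℝ) ^ (-r) :=
    (Real.continuous_const_rpow two_ne_zero).comp continuous_neg
  exact ge_of_tendsto
    ((hcont.tendsto k).mono_left (nhdsWithin_le_nhds (s := Set.Iio _)))
    (Filter.eventually_of_mem self_mem_nhdsWithin fun r hr' => hr r hr')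

end States

/-! ### From extractor definitions to weighted sums of deviations. -/

section Extractors

variable {n₁ n₂ m : ℕ}

/-- For diagonal sources the difference from the ideal state is diagonal with entries `p x * ∑ y,
deviation Ext x z y * q y`, so the `ℓ¹` norm of these entries is at most the trace norm. -/
lemma IsX1StrongExtractor.extractsFrom {k₁ k₂ ε : ℝ}
    {Ext : BitString n₁ → BitString n₂ → BitString m} (h : IsX1StrongExtractor k₁ k₂ ε Ext)
    {p : BitString n₁ → ℝ} (hp : ∀ x, 0 ≤ p x) (hp1 : ∑ x, p x = 1)
    (hpk : ∀ x, p x ≤ 2 ^ (-k₁)) : ExtractsFrom Ext p (2 ^ (-k₂)) ε := by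
  intro q hq hq1 hqk
  have h1 := h _ _ (isClassicalState_diagonal hp hp1) (isClassicalState_diagonal hq hq1)
    (le_minEntropy_diagonal hpk) (le_minEntropy_diagonal hqk)
  have h2 : applyFunction (fun x : BitString n₁ × BitString n₂ => (Ext x.1 x.2, x.1))
        ((Matrix.diagonal fun x => (p x : ℂ)) ⊗ₖ (Matrix.diagonal fun y => (q y : ℂ)))
      - maximallyMixed (BitString m) ⊗ₖ (Matrix.diagonal fun x => (p x : ℂ))
      = Matrix.diagonal fun i : BitString m × BitString n₁ =>
          ((p i.2 * ∑ y, deviation Ext i.2 i.1 y * q y : ℝ) : ℂ) := by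
    rw [applyFunction_eq_diagonal, maximallyMixed_eq_diagonal,
      Matrix.diagonal_kronecker_diagonal, Matrix.diagonal_kronecker_diagonal, Matrix.diagonal_sub]
    congr 1
    ext ⟨z, x⟩
    have hq1' : ∑ y, (q y : ℂ) = 1 := by exact_mod_cast hq1
    rw [Fintype.sum_prod_type]
    simp only [Matrix.diagonal_apply_eq, Prod.mk.injEq]
    rw [Finset.sum_eq_single x (fun x' _ hx => by simp [hx]) (by simp)]
    simp only [deviation, and_true, sub_mul, Finset.sum_sub_distrib, ← Finset.mul_sum, hq1,
      ite_mul, one_mul, zero_mul, mul_sub]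
    push_cast
    simp only [Finset.mul_sum, mul_ite, mul_zero, apply_ite Complex.ofReal, Complex.ofReal_zero]
    ring
  rw [traceDistance, h2] at h1
  have h3 := sum_abs_diag_le_traceNorm (M := Matrix.diagonal
    fun i : BitString m × BitString n₁ =>
      ((p i.2 * ∑ y, deviation Ext i.2 i.1 y * q y : ℝ) : ℂ))
    (Matrix.isHermitian_diagonal_of_self_adjoint _ (by
      ext i
      simp only [Pi.star_apply, RCLike.star_def, Complex.conj_ofReal]))
  simp only [Matrix.diagonal_apply_eq, Complex.ofReal_re, abs_mul, abs_of_nonneg (hp _)] at h3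
  rw [Fintype.sum_prod_type, Finset.sum_comm] at h3
  simp only [← Finset.mul_sum] at h3
  linarith

/-- Each block factors into a `C₁` part independent of `y` and a `C₂` part carrying all the
deviation, which is where the product form of the side information is used. -/
lemma applyFunctionLeft_productState_sub {C₁ C₂ : Type*} [Fintype C₁] [DecidableEq C₁]
    [Fintype C₂] [DecidableEq C₂] (Ext : BitString n₁ → BitString n₂ → BitString m)
    (ρ₁ : Matrix (BitString n₁ × C₁) (BitString n₁ × C₁) ℂ)
    (ρ₂ : Matrix (BitString n₂ × C₂) (BitString n₂ × C₂) ℂ) :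
    applyFunctionLeft (fun x : BitString n₁ × BitString n₂ => (Ext x.1 x.2, x.1))
        (productState ρ₁ ρ₂)
      - (maximallyMixed (BitString m) ⊗ₖ applyFunctionLeft Prod.fst
          (productState ρ₁ ρ₂)).submatrix
        (Equiv.prodAssoc (BitString m) (BitString n₁) (C₁ × C₂))
        (Equiv.prodAssoc (BitString m) (BitString n₁) (C₁ × C₂))
      = ∑ i : BitString m × BitString n₁, basisProjector i ⊗ₖ
          (ρ₁.submatrix (Prod.mk i.2) (Prod.mk i.2) ⊗ₖ
            ∑ y, (deviation Ext i.2 i.1 y : ℂ) • ρ₂.submatrix (Prod.mk y) (Prod.mk y)) := by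
  ext ⟨⟨z, x⟩, c₁, c₂⟩ ⟨⟨z', x'⟩, d₁, d₂⟩
  rw [sum_basisProjector_kronecker_apply, Matrix.sub_apply, applyFunctionLeft_apply,
    Matrix.submatrix_apply, Equiv.prodAssoc_apply, Equiv.prodAssoc_apply,
    Matrix.kroneckerMap_apply, applyFunctionLeft_apply, maximallyMixed_eq_diagonal,
    Matrix.diagonal_apply]
  by_cases hz : z = z'
  swap
  · simp [hz]
  by_cases hx : x = x'
  swap
  · simp [hx]
  subst hz hx
  simp only [if_true, Matrix.kroneckerMap_apply, Matrix.submatrix_apply, Matrix.sum_apply,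
    Matrix.smul_apply, smul_eq_mul, Fintype.sum_prod_type, productState,
    Equiv.prodProdProdComm_apply, Prod.mk.injEq]
  rw [Finset.sum_eq_single x (fun x' _ hx => by simp [hx]) (by simp),
    Finset.sum_eq_single x (fun x' _ hx => by simp [hx]) (by simp)]
  simp only [and_true, if_true, Finset.mul_sum, ← Finset.sum_sub_distrib]
  refine Finset.sum_congr rfl fun y _ => ?_
  rw [deviation]
  split_ifs <;> push_cast <;> ring

end Extractors

theorem mainTheorem7 {n₁ n₂ m : ℕ} (k₁ k₂ ε : ℝ) (hε : 0 < ε)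
    (Ext : BitString n₁ → BitString n₂ → BitString m)
    (hExt : IsX1StrongExtractor k₁ k₂ ε Ext) :
    IsX1StrongExtractorAgainstQuantumProduct.{u} k₁ (k₂ + Real.logb 2 (1 / ε))
      (Real.sqrt (2 ^ m * ε)) Ext := by
  intro C₁ C₂ _ _ _ _ ρ₁ ρ₂ hρ₁ hρ₂ hk₁ hk₂
  let p : BitString n₁ → ℝ := fun x => (ρ₁.submatrix (Prod.mk x) (Prod.mk x)).trace.re
  have hp : ∀ x, 0 ≤ p x := fun x => (hρ₁.1.1.submatrix _).trace_re_nonneg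
  have hp1 : ∑ x, p x = 1 := by
    rw [← Complex.re_sum, ← trace_eq_sum_trace_submatrix, hρ₁.1.2, Complex.one_re]
  have hσ : ∀ y, (ρ₂.submatrix (Prod.mk y) (Prod.mk y)).PosSemidef :=
    fun y => hρ₂.1.1.submatrix _
  have hσ1 : (∑ y, ρ₂.submatrix (Prod.mk y) (Prod.mk y)).trace = 1 := by
    rw [Matrix.trace_sum, ← trace_eq_sum_trace_submatrix, hρ₂.1.2]
  have hE : ExtractsFrom Ext p (2 ^ (-k₂)) ε :=
    hExt.extractsFrom hp hp1 (trace_submatrix_le_of_le_condMinEntropy hk₁)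
  have h1 := hE.sum_traceNorm_le hε hp hp1 hσ hσ1
    fun r hr => exists_posSemidef_of_le_condMinEntropy hk₂ hr
  have h2 := traceNorm_sum_basisProjector_kronecker_le
    (ρ := fun i : BitString m × BitString n₁ => ρ₁.submatrix (Prod.mk i.2) (Prod.mk i.2))
    (D := fun i => ∑ y, (deviation Ext i.2 i.1 y : ℂ) • ρ₂.submatrix (Prod.mk y) (Prod.mk y))
    (fun i => hρ₁.1.1.submatrix _)
    (fun i => Matrix.isHermitian_sum_real_smul (fun y => (hσ y).isHermitian) _)
  have h3 : ∀ f : BitString m → BitString n₁ → ℝ,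
      ∑ i : BitString m × BitString n₁, p i.2 * f i.1 i.2 = ∑ x, p x * ∑ z, f z x := by
    intro f
    rw [Fintype.sum_prod_type, Finset.sum_comm]
    simp only [← Finset.mul_sum]
  have hcard : (Fintype.card (BitString m) : ℝ) = 2 ^ m := by simp
  rw [hcard] at h1
  rw [traceDistance, applyFunctionLeft_productState_sub]
  -- The factor `1/2` in the trace distance cancels the `2` in front of the square root.
  linarith [(h2.trans_eq (h3 fun z x => traceNorm
    (∑ y, (deviation Ext x z y : ℂ) • ρ₂.submatrix (Prod.mk y) (Prod.mk y)))).trans h1]
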